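/- A Bayesian game $G$ with $M\ge 1$ optimizer actions, $N\ge 1$ learner actions and $C$ contexts consists of a probability distribution $(p_c)_{c\in[C]}$ on $[C]$ and utilities $u_O(i,j,c),u_L(i,j,c)\in[-1,1]$ for $i\in[M]$, $j\in[N]$, $c\in[C]$, extended bilinearly to mixed strategies $\alpha\in\Delta([M])$, $b\in\Delta([N])$. In each round the optimizer plays $\alpha\in\Delta([M])$ and the learner plays $\beta:[C]\to\Delta([N])$, and the optimizer receives the reward $u_O(\alpha,\beta)=\sum_{c}\sum_i\sum_j p_c\,\alpha_i\,\beta(c)_j\,u_O(i,j,c)$. A correlated equilibrium of $G$ is a family $(\mathcal F_c)_{c\in[C]}$ of distributions on $[M]\times[N]$ such that for all $c,c'\in[C]$ and all $\pi:[N]\to[N]$ $$\mathbb E_{(i,j)\sim\mathcal F_c}[u_L(i,j,c)]\ge \mathbb E_{(i,j)\sim\mathcal F_{c'}}[u_L(i,j,c)]\quad\text{and}\quad \mathbb E_{(i,j)\sim\mathcal F_c}[u_L(i,j,c)]\ge \mathbb E_{(i,j)\sim\mathcal F_{c}}[u_L(i,\pi(j),c)].$$ Let $\mathsf{CorrVal}(G)$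 be the maximum of $\sum_c p_c\,\mathbb E_{(i,j)\sim\mathcal F_c}[u_O(i,j,c)]$ over all correlated equilibria. A (deterministic, full-information) learning algorithm over $K$ arms outputs, given the number of rounds $T$ and the reward vectors $r^1,\dots,r^{t-1}$ of the earlier rounds, a distribution $\gamma^t\in\Delta([K])$. It is low-regret if there is a function $R(T)=o(T)$ such that $\max_{k}\sum_{t=1}^T r^t_k-\sum_{t=1}^T\langle\gamma^t,r^t\rangle\le R(T)$ for every $T$ and all $r^1,\dots,r^T\in[-1,1]^K$. Consider a learner who, for each $c\in[C]$ and $j\in[N]$, runs a low-regret algorithm $\mathcal A_{c,j}$ over $N+C$ arms. In round $t$, with $\gamma^t_{c,j}\in\Delta([N+C])$ the output of $\mathcal A_{c,j}$, the learner plays any $\beta^t:[C]\to\Delta([N])$ satisfying $$\beta^t(c)_j=\sum_{j'=1}^N\beta^t(c)_{j'}\Big(\gamma^t_{c,j',j}+\sum_{c'=1}^C\gamma^t_{c,j',N+c'}\,\beta^t(c')_j\Big)\qquad\text{for all } c\in[C],\ j\in[N];$$ the optimizer plays an arbitrary $\alpha^t\in\Delta([M])$; and each $\mathcal A_{c,j}$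 is updated with the reward vector $r^t_{c,j}\in[-1,1]^{N+C}$ given by $r^t_{c,j,j'}=\beta^t(c)_j\,u_L(\alpha^t,j',c)$ for $j'\in[N]$ and $r^t_{c,j,N+c'}=\beta^t(c)_j\,u_L(\alpha^t,\beta^t(c'),c)$ for $c'\in[C]$. Theorem. The maximum defining $\mathsf{CorrVal}(G)$ is attained, and there is a function $f(T)=o(T)$, depending only on $G$ and the algorithms $\mathcal A_{c,j}$, such that for every $T$, every choice of the optimizer's strategies $\alpha^1,\dots,\alpha^T$ and every choice of the solutions $\beta^1,\dots,\beta^T$, $$\sum_{t=1}^T u_O(\alpha^t,\beta^t)\le \mathsf{CorrVal}(G)\,T+f(T).$$ -/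

import Mathlib

open scoped BigOperators
open Filter Asymptotics

noncomputable section

/-! ### Online learning (fractional, full-information, deterministic) -/

/-- A deterministic online learning algorithm over a finite set `ι` of arms: given the number `T`
of rounds, the number `t` of rounds already played, and the `t` reward vectors revealed so far, it
outputs the distribution over arms to be played next. -/
structure LearningAlgorithm (ι : Type) [Fintype ι] where
  play : (T t : ℕ) → (Fin t → ι → ℝ) → stdSimplex ℝ ι

namespace LearningAlgorithm

variable {ι : Type} [Fintype ι]

/-- The part of a `T`-round sequence that precedes round `t` (rounds are `0, …, T - 1`). -/
def past {X : Type} {T : ℕ} (x : Fin T → X) (t : Fin T) : Fin (t : ℕ) → X :=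
  fun s => x (Fin.castLE t.isLt.le s)

/-- External regret on the reward sequence `r`: the reward of the best fixed arm in hindsight minus
the reward of the algorithm. -/
def externalRegret (A : LearningAlgorithm ι) {T : ℕ} (r : Fin T → ι → ℝ) : ℝ :=
  (⨆ k : ι, ∑ t : Fin T, r t k) -
    ∑ t : Fin T, ∑ k : ι, (A.play T t (past r t)).1 k * r t k

/-- The algorithm sustains `o(T)` external regret on every `T`-round instance with rewards in
`[-1, 1]`. -/
def IsLowRegret (A : LearningAlgorithm ι) : Prop :=
  ∃ R : ℕ → ℝ, (R =o[atTop] fun T : ℕ => (T : ℝ)) ∧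
    ∀ (T : ℕ) (r : Fin T → ι → ℝ), (∀ t k, r t k ∈ Set.Icc (-1 : ℝ) 1) →
      A.externalRegret r ≤ R T

end LearningAlgorithm

/-! ### Bayesian games -/

/-- A Bayesian game with `M` optimizer actions, `N` learner actions and `C` contexts. Context `c`
has probability `p c`; it is seen by the learner only. -/
structure BayesianGame (M N C : ℕ) where
  p : Fin C → ℝ
  p_nonneg : ∀ c, 0 ≤ p c
  p_sum : ∑ c, p c = 1
  uO : Fin M → Fin N → Fin C → ℝ
  uL : Fin M → Fin N → Fin C → ℝ
  uO_bdd : ∀ i j c, |uO i j c| ≤ 1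
  uL_bdd : ∀ i j c, |uL i j c| ≤ 1

namespace BayesianGame

variable {M N C : ℕ} (G : BayesianGame M N C)

/-- The learner's utility `u_L(α, j, c)`. -/
def learnerPure (α : stdSimplex ℝ (Fin M)) (j : Fin N) (c : Fin C) : ℝ :=
  ∑ i, α.1 i * G.uL i j c

/-- The learner's utility `u_L(α, b, c)` for a mixed strategy `b`. -/
def learnerMixed (α : stdSimplex ℝ (Fin M)) (b : stdSimplex ℝ (Fin N)) (c : Fin C) : ℝ :=
  ∑ i, ∑ j, α.1 i * b.1 j * G.uL i j c

/-- The optimizer's one-round reward `u_O(α, β)`. -/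
def optimizerReward (α : stdSimplex ℝ (Fin M)) (β : Fin C → stdSimplex ℝ (Fin N)) : ℝ :=
  ∑ c, ∑ i, ∑ j, G.p c * α.1 i * (β c).1 j * G.uO i j c

/-! ### Correlated equilibria (constraints for the learner only) -/

/-- The collection `F c` of distributions over action profiles is a correlated equilibrium: the
learner has no incentive to misreport the context and no incentive to swap actions. -/
def IsCorrelatedEquilibrium (F : Fin C → stdSimplex ℝ (Fin M × Fin N)) : Prop :=
  (∀ c c' : Fin C,
    ∑ a : Fin M × Fin N, (F c').1 a * G.uL a.1 a.2 c ≤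
      ∑ a : Fin M × Fin N, (F c).1 a * G.uL a.1 a.2 c) ∧
  (∀ (c : Fin C) (π : Fin N → Fin N),
    ∑ a : Fin M × Fin N, (F c).1 a * G.uL a.1 (π a.2) c ≤
      ∑ a : Fin M × Fin N, (F c).1 a * G.uL a.1 a.2 c)

/-- The optimizer's expected utility under the collection `F`. -/
def optimizerValue (F : Fin C → stdSimplex ℝ (Fin M × Fin N)) : ℝ :=
  ∑ c, G.p c * ∑ a : Fin M × Fin N, (F c).1 a * G.uO a.1 a.2 c

/-- The optimizer's values over all correlated equilibria. -/
def corrValues : Set ℝ :=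
  {v | ∃ F, G.IsCorrelatedEquilibrium F ∧ G.optimizerValue F = v}

/-- The correlated Stackelberg value. -/
def corrVal : ℝ := sSup G.corrValues

/-! ### The algorithm that swaps between contexts

The `N + C` arms are `Fin N ⊕ Fin C`: `Sum.inl j` stands for action `j`, `Sum.inr c` for
context `c`. -/

/-- `β` solves the quadratic system with coefficients `γ c j`. -/
def IsQuadraticFixedPoint (γ : Fin C → Fin N → stdSimplex ℝ (Fin N ⊕ Fin C))
    (β : Fin C → stdSimplex ℝ (Fin N)) : Prop :=
  ∀ (c : Fin C) (j : Fin N),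
    (β c).1 j = ∑ j' : Fin N, (β c).1 j' *
      ((γ c j').1 (Sum.inl j) + ∑ c' : Fin C, (γ c j').1 (Sum.inr c') * (β c').1 j)

/-- The reward vector passed to the sub-algorithm of `(c, j)` after a round in which the optimizer
played `α` and the learner played `β`. -/
def armReward (α : stdSimplex ℝ (Fin M)) (β : Fin C → stdSimplex ℝ (Fin N))
    (c : Fin C) (j : Fin N) : Fin N ⊕ Fin C → ℝ
  | Sum.inl j' => (β c).1 j * G.learnerPure α j' c
  | Sum.inr c' => (β c).1 j * G.learnerMixed α (β c') c

/-- `(α, β)` is a possible `T`-round play against a learner who runs the sub-algorithms `A c j`: in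
every round `t`, `β t` is a solution of the quadratic system whose coefficients are the current
outputs of the sub-algorithms. The optimizer's strategies `α t` are arbitrary. -/
def IsContextSwapPlay (A : Fin C → Fin N → LearningAlgorithm (Fin N ⊕ Fin C)) {T : ℕ}
    (α : Fin T → stdSimplex ℝ (Fin M)) (β : Fin T → Fin C → stdSimplex ℝ (Fin N)) : Prop :=
  ∀ t : Fin T, IsQuadraticFixedPoint
    (fun c j => (A c j).play T t
      (LearningAlgorithm.past (fun s => G.armReward (α s) (β s) c j) t))
    (β t)

end BayesianGame

end

open scoped Topology

/-! For each context, average the product distributions of the optimizer's and learner's strategies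
over time. The resulting family earns the optimizer exactly the average reward
(`sum_optimizerReward_eq`), so it suffices that it is nearly a correlated equilibrium. The quadratic
system makes the rewards of the sub-algorithms of a context add up to the learner's utility there
(`IsQuadraticFixedPoint.sum_mul_armReward`). Adding their regret bounds against arms `σ j` therefore
controls every deviation: constant context arms encode misreporting, action arms encode swaps. Each
constraint is violated by at most the total regret over `T` (`equilibriumGap_averageProduct_le`). By
compactness, the best value over such approximate equilibria tends to the exact one
(`tendsto_sSup_image_relaxation`). -/

/-- The maximum of a continuous function over a compact set cut out by finitely many continuous
inequalities depends continuously on a common relaxation `e n → 0` of these inequalities. -/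
theorem tendsto_sSup_image_relaxation {X ι : Type*} [TopologicalSpace X] [CompactSpace X]
    [Fintype ι] {h : ι → X → ℝ} (hh : ∀ k, Continuous (h k)) {v : X → ℝ} (hv : Continuous v)
    (hne : ∃ x, ∀ k, h k x ≤ 0) {e : ℕ → ℝ} (he0 : ∀ n, 0 ≤ e n)
    (he : Tendsto e atTop (𝓝 0)) :
    Tendsto (fun n => sSup (v '' {x | ∀ k, h k x ≤ e n})) atTop
      (𝓝 (sSup (v '' {x | ∀ k, h k x ≤ 0}))) := by
  have hbdd : ∀ s : Set X, BddAbove (v '' s) := fun s =>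
    (isCompact_range hv).bddAbove.mono (Set.image_subset_range v s)
  set V := sSup (v '' {x | ∀ k, h k x ≤ 0}) with hV
  have hlow : ∀ n, V ≤ sSup (v '' {x | ∀ k, h k x ≤ e n}) := fun n =>
    csSup_le_csSup (hbdd _) (Set.Nonempty.image v hne)
      (Set.image_mono fun x hx k => (hx k).trans (he0 n))
  rw [Metric.tendsto_atTop']
  intro δ hδ
  -- The total violation `m` vanishes only at feasible points, where `v ≤ V`. Hence it is bounded
  -- below by a positive constant on the compact set where `v` exceeds `V` by `δ / 2`.
  set m : X → ℝ := fun x => ∑ k, max 0 (h k x) with hm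
  have hmc : Continuous m := by fun_prop
  have hK : IsCompact {x | V + δ / 2 ≤ v x} :=
    (isClosed_le continuous_const hv).isCompact
  obtain ⟨ε, hε, hεm⟩ : ∃ ε > 0, ∀ x, V + δ / 2 ≤ v x → ε ≤ m x := by
    rcases Set.eq_empty_or_nonempty {x | V + δ / 2 ≤ v x} with h0 | h0
    · exact ⟨1, one_pos, fun x hx => absurd (show x ∈ {x | V + δ / 2 ≤ v x} from hx)
        (by simp [h0])⟩
    · obtain ⟨x₀, hx₀, hmin⟩ := hK.exists_isMinOn h0 hmc.continuousOn
      refine ⟨m x₀, ?_, fun x hx => hmin hx⟩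
      by_contra hneg
      have hz : ∀ k, h k x₀ ≤ 0 := fun k => by
        have := Finset.single_le_sum (f := fun k => max 0 (h k x₀))
          (fun k _ => le_max_left _ _) (Finset.mem_univ k)
        exact (le_max_right 0 _).trans (this.trans (not_lt.mp hneg))
      have h1 : v x₀ ≤ V := le_csSup (hbdd _) ⟨x₀, hz, rfl⟩
      have h2 : V + δ / 2 ≤ v x₀ := hx₀
      linarith
  have hev : ∀ᶠ n in atTop, (Fintype.card ι : ℝ) * e n < ε := by
    have := he.const_mul (Fintype.card ι : ℝ)
    rw [mul_zero] at this
    exact this.eventually (gt_mem_nhds hε)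
  obtain ⟨n₀, hn₀⟩ := eventually_atTop.mp hev
  refine ⟨n₀, fun n hn => ?_⟩
  have hup : sSup (v '' {x | ∀ k, h k x ≤ e n}) ≤ V + δ / 2 := by
    obtain ⟨x, hx⟩ := hne
    refine csSup_le ⟨v x, x, fun k => (hx k).trans (he0 n), rfl⟩ ?_
    rintro _ ⟨y, hy, rfl⟩
    by_contra hlt
    have h1 := hεm y (not_le.mp hlt).le
    have h2 : m y ≤ ∑ _k : ι, e n := Finset.sum_le_sum fun k _ => max_le (he0 n) (hy k)
    rw [Finset.sum_const, Finset.card_univ, nsmul_eq_mul] at h2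
    linarith [hn₀ n hn.le]
  rw [Real.dist_eq, abs_of_nonneg (sub_nonneg.mpr (hlow n))]
  linarith

/-! ### Time-averaged play -/

/-- The average over `t` of the product distributions `x t ⊗ y t`. -/
noncomputable def averageProduct {κ ι : Type*} [Fintype κ] [Fintype ι] {T : ℕ} (hT : 0 < T)
    (x : Fin T → stdSimplex ℝ κ) (y : Fin T → stdSimplex ℝ ι) : stdSimplex ℝ (κ × ι) :=
  ⟨fun a => (∑ t, (x t).1 a.1 * (y t).1 a.2) / T,
    fun a => div_nonneg (Finset.sum_nonneg fun t _ => mul_nonneg ((x t).2.1 _) ((y t).2.1 _))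
      T.cast_nonneg, by
    have h1 : ∀ t, ∑ a : κ × ι, (x t).1 a.1 * (y t).1 a.2 = 1 := fun t => by
      rw [Fintype.sum_prod_type]
      simp_rw [← Finset.mul_sum, (y t).2.2, mul_one, (x t).2.2]
    rw [← Finset.sum_div, Finset.sum_comm]
    simp_rw [h1]
    simp [hT.ne']⟩

theorem sum_averageProduct_mul {κ ι : Type*} [Fintype κ] [Fintype ι] {T : ℕ} (hT : 0 < T)
    (x : Fin T → stdSimplex ℝ κ) (y : Fin T → stdSimplex ℝ ι) (g : κ → ι → ℝ) :
    ∑ a, (averageProduct hT x y).1 a * g a.1 a.2 =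
      (∑ t, ∑ i, ∑ j, (x t).1 i * (y t).1 j * g i j) / T := by
  simp_rw [← Fintype.sum_prod_type' (f := fun i j => (x _).1 i * (y _).1 j * g i j)]
  rw [Finset.sum_comm, Finset.sum_div]
  refine Finset.sum_congr rfl fun a _ => ?_
  simp only [averageProduct]
  rw [div_mul_eq_mul_div, Finset.sum_mul]

/-! ### From external regret to regret against context and action swaps -/

namespace LearningAlgorithm

theorem sum_sub_sum_play_le_externalRegret {ι : Type} [Fintype ι] (A : LearningAlgorithm ι)
    {T : ℕ} (r : Fin T → ι → ℝ) (k : ι) :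
    ∑ t : Fin T, r t k - ∑ t : Fin T, ∑ l, (A.play T t (past r t)).1 l * r t l ≤ A.externalRegret r :=
  sub_le_sub_right (le_ciSup (f := fun k => ∑ t, r t k) (Set.finite_range _).bddAbove k) _

end LearningAlgorithm

namespace BayesianGame

variable {M N C : ℕ} (G : BayesianGame M N C)

theorem learnerMixed_eq_sum_learnerPure (α : stdSimplex ℝ (Fin M)) (b : stdSimplex ℝ (Fin N))
    (c : Fin C) : G.learnerMixed α b c = ∑ j, b.1 j * G.learnerPure α j c := by
  simp only [learnerMixed, learnerPure, Finset.mul_sum]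
  rw [Finset.sum_comm]
  exact Finset.sum_congr rfl fun j _ => Finset.sum_congr rfl fun i _ => by ring

theorem abs_sum_mul_le_one {ι : Type*} [Fintype ι] (x : stdSimplex ℝ ι) {g : ι → ℝ}
    (hg : ∀ i, |g i| ≤ 1) : |∑ i, x.1 i * g i| ≤ 1 :=
  calc |∑ i, x.1 i * g i| ≤ ∑ i, |x.1 i * g i| := Finset.abs_sum_le_sum_abs _ _
    _ ≤ ∑ i, x.1 i := Finset.sum_le_sum fun i _ => by
        rw [abs_mul, abs_of_nonneg (x.2.1 i)]
        exact mul_le_of_le_one_right (x.2.1 i) (hg i)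
    _ = 1 := x.2.2

theorem abs_learnerPure_le_one (α : stdSimplex ℝ (Fin M)) (j : Fin N) (c : Fin C) :
    |G.learnerPure α j c| ≤ 1 :=
  abs_sum_mul_le_one α fun i => G.uL_bdd i j c

theorem abs_learnerMixed_le_one (α : stdSimplex ℝ (Fin M)) (b : stdSimplex ℝ (Fin N))
    (c : Fin C) : |G.learnerMixed α b c| ≤ 1 := by
  rw [learnerMixed_eq_sum_learnerPure]
  exact abs_sum_mul_le_one b fun j => G.abs_learnerPure_le_one α j c

theorem armReward_mem_Icc (α : stdSimplex ℝ (Fin M)) (β : Fin C → stdSimplex ℝ (Fin N))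
    (c : Fin C) (j : Fin N) (k : Fin N ⊕ Fin C) : G.armReward α β c j k ∈ Set.Icc (-1 : ℝ) 1 := by
  have h0 := (β c).2.1 j
  have h1 : (β c).1 j ≤ 1 := by
    rw [← (β c).2.2]
    exact Finset.single_le_sum (fun i _ => (β c).2.1 i) (Finset.mem_univ j)
  have key : ∀ u : ℝ, |u| ≤ 1 → (β c).1 j * u ∈ Set.Icc (-1 : ℝ) 1 := fun u hu => by
    rw [Set.mem_Icc, ← abs_le, abs_mul, abs_of_nonneg h0]
    exact mul_le_one₀ h1 (abs_nonneg u) hu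
  cases k with
  | inl j' => exact key _ (G.abs_learnerPure_le_one α j' c)
  | inr c' => exact key _ (G.abs_learnerMixed_le_one α (β c') c)

/-- At a solution of the quadratic system, the rewards of the sub-algorithms for the context `c`
add up to the reward of the learner. -/
theorem IsQuadraticFixedPoint.sum_mul_armReward
    {γ : Fin C → Fin N → stdSimplex ℝ (Fin N ⊕ Fin C)} {β : Fin C → stdSimplex ℝ (Fin N)}
    (h : IsQuadraticFixedPoint γ β) (α : stdSimplex ℝ (Fin M)) (c : Fin C) :
    ∑ j, ∑ k, (γ c j).1 k * G.armReward α β c j k = G.learnerMixed α (β c) c := by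
  -- Collecting the coefficients of `learnerPure α l c` produces the summands of the right-hand side
  -- of the quadratic system at `(c, l)`.
  have hj : ∀ j, ∑ k, (γ c j).1 k * G.armReward α β c j k =
      ∑ l, (β c).1 j * ((γ c j).1 (Sum.inl l) +
        ∑ c', (γ c j).1 (Sum.inr c') * (β c').1 l) * G.learnerPure α l c := fun j => by
    simp only [Fintype.sum_sum_type, armReward, learnerMixed_eq_sum_learnerPure, mul_add, add_mul,
      Finset.sum_add_distrib, Finset.mul_sum, Finset.sum_mul]
    congr 1
    · exact Finset.sum_congr rfl fun l _ => by ring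
    · rw [Finset.sum_comm]
      exact Finset.sum_congr rfl fun l _ => Finset.sum_congr rfl fun c' _ => by ring
  simp_rw [hj]
  rw [Finset.sum_comm, learnerMixed_eq_sum_learnerPure]
  refine Finset.sum_congr rfl fun l _ => ?_
  rw [← Finset.sum_mul, ← h c l]

/-- The learner's regret against replacing, for the context `c`, each action `j` by the arm
`σ j`. -/
theorem IsContextSwapPlay.sum_armReward_sub_le
    {A : Fin C → Fin N → LearningAlgorithm (Fin N ⊕ Fin C)} {R : Fin C → Fin N → ℕ → ℝ}
    (hR : ∀ c j (T : ℕ) (r : Fin T → Fin N ⊕ Fin C → ℝ),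
      (∀ t k, r t k ∈ Set.Icc (-1 : ℝ) 1) → (A c j).externalRegret r ≤ R c j T)
    {T : ℕ} {α : Fin T → stdSimplex ℝ (Fin M)} {β : Fin T → Fin C → stdSimplex ℝ (Fin N)}
    (h : G.IsContextSwapPlay A α β) (c : Fin C) (σ : Fin N → Fin N ⊕ Fin C) :
    ∑ t, ∑ j, G.armReward (α t) (β t) c j (σ j) - ∑ t, G.learnerMixed (α t) (β t c) c ≤
      ∑ j, R c j T := by
  have h1 := Finset.sum_le_sum fun j (_ : j ∈ Finset.univ) =>
    ((A c j).sum_sub_sum_play_le_externalRegret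
      (fun s => G.armReward (α s) (β s) c j) (σ j)).trans
      (hR c j T _ fun t k => G.armReward_mem_Icc (α t) (β t) c j k)
  -- The sum over rounds is moved outside, since the fixed-point identity holds round by round.
  rw [Finset.sum_sub_distrib, Finset.sum_comm, Finset.sum_comm (f := fun j t => ∑ l, _)] at h1
  rwa [Finset.sum_congr rfl fun t _ => (h t).sum_mul_armReward G (α t) c] at h1

/-! ### Correlated equilibria as a compact set -/

/-- The amounts by which the collection `F` violates the inequalities that define a correlated
equilibrium. -/
def equilibriumGap :
    (Fin C × Fin C) ⊕ (Fin C × (Fin N → Fin N)) →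
      (Fin C → stdSimplex ℝ (Fin M × Fin N)) → ℝ
  | Sum.inl q, F => ∑ a : Fin M × Fin N, (F q.2).1 a * G.uL a.1 a.2 q.1 -
      ∑ a : Fin M × Fin N, (F q.1).1 a * G.uL a.1 a.2 q.1
  | Sum.inr q, F => ∑ a : Fin M × Fin N, (F q.1).1 a * G.uL a.1 (q.2 a.2) q.1 -
      ∑ a : Fin M × Fin N, (F q.1).1 a * G.uL a.1 a.2 q.1

theorem isCorrelatedEquilibrium_iff (F : Fin C → stdSimplex ℝ (Fin M × Fin N)) :
    G.IsCorrelatedEquilibrium F ↔ ∀ k, G.equilibriumGap k F ≤ 0 := by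
  simp [IsCorrelatedEquilibrium, equilibriumGap, Sum.forall, Prod.forall]

theorem continuous_sum_apply_mul (c : Fin C) (g : Fin M × Fin N → ℝ) :
    Continuous fun F : Fin C → stdSimplex ℝ (Fin M × Fin N) => ∑ a, (F c).1 a * g a :=
  by
  have h : ∀ a, Continuous fun F : Fin C → stdSimplex ℝ (Fin M × Fin N) => (F c).1 a := fun a =>
    (continuous_apply a).comp (continuous_subtype_val.comp (continuous_apply c))
  exact continuous_finsetSum _ fun a _ => (h a).mul continuous_const

theorem continuous_equilibriumGap (k : (Fin C × Fin C) ⊕ (Fin C × (Fin N → Fin N))) :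
    Continuous (G.equilibriumGap k) := by
  cases k with
  | inl q => exact (continuous_sum_apply_mul _ _).sub (continuous_sum_apply_mul _ _)
  | inr q => exact (continuous_sum_apply_mul _ _).sub (continuous_sum_apply_mul _ _)

theorem continuous_optimizerValue : Continuous G.optimizerValue :=
  continuous_finsetSum _ fun _ _ => continuous_const.mul (continuous_sum_apply_mul _ _)

theorem corrValues_eq_image :
    G.corrValues = G.optimizerValue '' {F | ∀ k, G.equilibriumGap k F ≤ 0} := by
  ext v
  simp [corrValues, isCorrelatedEquilibrium_iff]

/-- The optimizer commits to a pure action, and the learner best-responds in every context. -/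
theorem exists_isCorrelatedEquilibrium (hM : 0 < M) (hN : 0 < N) :
    ∃ F, G.IsCorrelatedEquilibrium F := by
  classical
  have : Nonempty (Fin N) := ⟨⟨0, hN⟩⟩
  let i : Fin M := ⟨0, hM⟩
  choose b hb using fun c => Finite.exists_max fun j => G.uL i j c
  -- The action `i` is the same in all contexts, so a misreport only changes the learner's action,
  -- and both constraints reduce to the optimality of `b c`.
  refine ⟨fun c => ⟨Pi.single (i, b c) 1, single_mem_stdSimplex ℝ _⟩, ?_, ?_⟩
  · intro c c'
    simpa [Pi.single_apply] using hb c (b c')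
  · intro c π
    simpa [Pi.single_apply] using hb c (π (b c))

theorem isGreatest_corrVal (hM : 0 < M) (hN : 0 < N) : IsGreatest G.corrValues G.corrVal := by
  have hc : IsCompact G.corrValues := by
    rw [corrValues_eq_image, Set.ofPred_forall]
    exact (isClosed_iInter fun k => isClosed_le (G.continuous_equilibriumGap k)
      continuous_const).isCompact.image G.continuous_optimizerValue
  obtain ⟨F, hF⟩ := G.exists_isCorrelatedEquilibrium hM hN
  exact hc.isGreatest_sSup ⟨_, F, hF, rfl⟩

theorem equilibriumGap_averageProduct_le
    {A : Fin C → Fin N → LearningAlgorithm (Fin N ⊕ Fin C)} {R : Fin C → Fin N → ℕ → ℝ}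
    (hR : ∀ c j (T : ℕ) (r : Fin T → Fin N ⊕ Fin C → ℝ),
      (∀ t k, r t k ∈ Set.Icc (-1 : ℝ) 1) → (A c j).externalRegret r ≤ R c j T)
    {T : ℕ} (hT : 0 < T) {α : Fin T → stdSimplex ℝ (Fin M)}
    {β : Fin T → Fin C → stdSimplex ℝ (Fin N)} (h : G.IsContextSwapPlay A α β)
    (k : (Fin C × Fin C) ⊕ (Fin C × (Fin N → Fin N))) :
    G.equilibriumGap k (fun c => averageProduct hT α fun t => β t c) ≤
      (∑ c, ∑ j, |R c j T|) / T := by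
  have hsum : ∀ c, ∑ j, R c j T ≤ ∑ c, ∑ j, |R c j T| := fun c =>
    (Finset.sum_le_sum fun j _ => le_abs_self _).trans
      (Finset.single_le_sum (f := fun c => ∑ j, |R c j T|)
        (fun c _ => Finset.sum_nonneg fun j _ => abs_nonneg _) (Finset.mem_univ c))
  rcases k with ⟨c, c'⟩ | ⟨c, π⟩
  -- Misreporting `c'`: every action is replaced by the same context arm, and the weights `(β t c).1
  -- j` sum to one.
  · have h1 := h.sum_armReward_sub_le G hR c fun _ => Sum.inr c'
    have h2 : ∀ t, ∑ j, G.armReward (α t) (β t) c j (Sum.inr c') =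
        G.learnerMixed (α t) (β t c') c := fun t => by
      simp only [armReward, ← Finset.sum_mul, (β t c).2.2, one_mul]
    simp only [h2] at h1
    simp only [equilibriumGap]
    rw [sum_averageProduct_mul hT α _ fun i j => G.uL i j c,
      sum_averageProduct_mul hT α _ fun i j => G.uL i j c, ← sub_div]
    exact div_le_div_of_nonneg_right (h1.trans (hsum c)) T.cast_nonneg
  · have h1 := h.sum_armReward_sub_le G hR c fun j => Sum.inl (π j)
    have h2 : ∀ t, ∑ j, G.armReward (α t) (β t) c j (Sum.inl (π j)) =
        ∑ i, ∑ j, (α t).1 i * (β t c).1 j * G.uL i (π j) c := fun t => by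
      simp only [armReward, learnerPure, Finset.mul_sum]
      rw [Finset.sum_comm]
      exact Finset.sum_congr rfl fun i _ => Finset.sum_congr rfl fun j _ => by ring
    simp only [h2] at h1
    simp only [equilibriumGap]
    rw [sum_averageProduct_mul hT α _ fun i j => G.uL i (π j) c,
      sum_averageProduct_mul hT α _ fun i j => G.uL i j c, ← sub_div]
    exact div_le_div_of_nonneg_right (h1.trans (hsum c)) T.cast_nonneg

theorem sum_optimizerReward_eq {T : ℕ} (hT : 0 < T) (α : Fin T → stdSimplex ℝ (Fin M))
    (β : Fin T → Fin C → stdSimplex ℝ (Fin N)) :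
    ∑ t, G.optimizerReward (α t) (β t) =
      T * G.optimizerValue fun c => averageProduct hT α fun t => β t c := by
  have hT' : (T : ℝ) ≠ 0 := by exact_mod_cast hT.ne'
  simp only [optimizerValue, optimizerReward]
  rw [Finset.mul_sum, Finset.sum_comm]
  refine Finset.sum_congr rfl fun c _ => ?_
  rw [sum_averageProduct_mul hT α _ fun i j => G.uO i j c, mul_left_comm, mul_div_cancel₀ _ hT',
    Finset.mul_sum]
  simp only [Finset.mul_sum, mul_assoc]

end BayesianGame

theorem mainTheorem8 {M N C : ℕ} (hM : 0 < M) (hN : 0 < N) (G : BayesianGame M N C)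
    (A : Fin C → Fin N → LearningAlgorithm (Fin N ⊕ Fin C))
    (hA : ∀ c j, (A c j).IsLowRegret) :
    IsGreatest G.corrValues G.corrVal ∧
      ∃ f : ℕ → ℝ, (f =o[atTop] fun T : ℕ => (T : ℝ)) ∧
        ∀ (T : ℕ) (α : Fin T → stdSimplex ℝ (Fin M))
          (β : Fin T → Fin C → stdSimplex ℝ (Fin N)),
          G.IsContextSwapPlay A α β →
            ∑ t : Fin T, G.optimizerReward (α t) (β t) ≤ G.corrVal * T + f T := by
  refine ⟨G.isGreatest_corrVal hM hN, ?_⟩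
  choose R hRo hR using hA
  -- Absolute values give one nonnegative bound that serves all contexts at once.
  set e : ℕ → ℝ := fun T => (∑ c, ∑ j, |R c j T|) / T with he
  have he0 : ∀ T, 0 ≤ e T := fun T => div_nonneg
    (Finset.sum_nonneg fun c _ => Finset.sum_nonneg fun j _ => abs_nonneg _) T.cast_nonneg
  have hlim : Tendsto e atTop (𝓝 0) :=
    (IsLittleO.fun_sum fun c _ => IsLittleO.fun_sum fun j _ => (hRo c j).abs_left).tendsto_div_nhds_zero
  obtain ⟨F₀, hF₀⟩ := G.exists_isCorrelatedEquilibrium hM hN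
  have hV := tendsto_sSup_image_relaxation G.continuous_equilibriumGap
    G.continuous_optimizerValue ⟨F₀, (G.isCorrelatedEquilibrium_iff F₀).mp hF₀⟩ he0 hlim
  rw [← G.corrValues_eq_image] at hV
  set W : ℕ → ℝ := fun T => sSup (G.optimizerValue '' {F | ∀ k, G.equilibriumGap k F ≤ e T})
  have hW : Tendsto (fun T => W T - G.corrVal) atTop (𝓝 0) := by
    simpa [BayesianGame.corrVal] using hV.sub_const G.corrVal
  -- `W` involves only `G` and the regret bounds, so this error is uniform over all plays.
  refine ⟨fun T => (W T - G.corrVal) * T, ?_, ?_⟩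
  · simpa using ((isLittleO_one_iff ℝ).mpr hW).mul_isBigO
      (isBigO_refl (fun T : ℕ => (T : ℝ)) atTop)
  · intro T α β hplay
    rcases Nat.eq_zero_or_pos T with rfl | hT
    · simp
    · have hle : G.optimizerValue (fun c => averageProduct hT α fun t => β t c) ≤ W T :=
        le_csSup ((isCompact_range G.continuous_optimizerValue).bddAbove.mono
          (Set.image_subset_range _ _))
          ⟨_, G.equilibriumGap_averageProduct_le hR hT hplay, rfl⟩
      rw [G.sum_optimizerReward_eq hT]
      calc (T : ℝ) * _ ≤ T * W T := mul_le_mul_of_nonneg_left hle T.cast_nonneg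
        _ = _ := by ring
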